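/- Let $P(z)$ be a complex polynomial of degree $n$ having all its zeros in $|z|\le k$, where $0<k\le 1$, and let $m=\min_{|z|=k}|P(z)|$. Then for every real $p>0$ and every $\beta\in\mathbb{C}$ with $|\beta|\le 1$, $$n\left(\int_0^{2\pi}\left|P(e^{i\theta})+\frac{m\beta}{k^{n-1}}\right|^p d\theta\right)^{1/p}\le\left(\int_0^{2\pi}\left|1+ke^{i\theta}\right|^p d\theta\right)^{1/p}\max_{|z|=1}|P'(z)|.$$ -/

import Mathlib

open Polynomial

/-- The minimum of `|P(z)|` on the circle `|z| = r`. -/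
noncomputable def minModulus (P : ℂ[X]) (r : ℝ) : ℝ :=
  sInf ((fun z : ℂ => ‖P.eval z‖) '' Metric.sphere (0 : ℂ) r)

/-- The maximum of `|P(z)|` on the circle `|z| = r`. -/
noncomputable def maxModulus (P : ℂ[X]) (r : ℝ) : ℝ :=
  sSup ((fun z : ℂ => ‖P.eval z‖) '' Metric.sphere (0 : ℂ) r)

/-- The infimum in `minModulus` is attained, so it is a minimum. -/
theorem minModulus_isLeast (P : ℂ[X]) {r : ℝ} (hr : 0 ≤ r) :
    IsLeast ((fun z : ℂ => ‖P.eval z‖) '' Metric.sphere (0 : ℂ) r) (minModulus P r) :=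
  ((isCompact_sphere (0 : ℂ) r).image P.continuous.norm).isLeast_sInf
    ((NormedSpace.sphere_nonempty.mpr hr).image _)

/-- The supremum in `maxModulus` is attained, so it is a maximum. -/
theorem maxModulus_isGreatest (P : ℂ[X]) {r : ℝ} (hr : 0 ≤ r) :
    IsGreatest ((fun z : ℂ => ‖P.eval z‖) '' Metric.sphere (0 : ℂ) r) (maxModulus P r) :=
  ((isCompact_sphere (0 : ℂ) r).image P.continuous.norm).isGreatest_sSup
    ((NormedSpace.sphere_nonempty.mpr hr).image _)

/-- The quantity `(∫₀^{2π} |f(e^{iθ})|^p dθ)^{1/p}` (no factor `1 / (2π)`). -/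
noncomputable def circleLp (p : ℝ) (f : ℂ → ℂ) : ℝ :=
  (∫ θ in (0 : ℝ)..2 * Real.pi, ‖f (Complex.exp (θ * Complex.I))‖ ^ p) ^ (1 / p)

/-- For a continuous `f` and `p > 0` the integrand in `circleLp` is integrable. -/
theorem circleLp_intervalIntegrable {p : ℝ} (hp : 0 < p) {f : ℂ → ℂ} (hf : Continuous f) :
    IntervalIntegrable (fun θ : ℝ => ‖f (Complex.exp (θ * Complex.I))‖ ^ p)
      MeasureTheory.volume 0 (2 * Real.pi) := by
  apply Continuous.intervalIntegrable
  have h : Continuous fun θ : ℝ => ‖f (Complex.exp (θ * Complex.I))‖ := by fun_prop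
  exact h.rpow_const fun _ => Or.inr hp.le

/-! ### Subordination on the unit circle -/

/-! Let `k < 1`, let `c` be the added constant, and set `A = zP'`, `B = n(P + c) - zP'`. On the unit
circle `n(P + c) = A(1 + kφ(1/z))`, where `φ(1/z) = B/(kA)`. Passing to reciprocal polynomials makes
`φ` holomorphic on the closed disc (Gauss–Lucas keeps the zeros of `P'` inside), and `φ(0) = 0`
because the leading terms of `nP` and `zP'` cancel. The pointwise bound
`norm_natDegree_mul_eval_sub_add_le` gives `|φ| ≤ 1`, so `1 + kφ` is subordinate to `1 + kz`.
Littlewood's inequality (`circleAverage_norm_one_add_mul_rpow_le`) compares their `L^p` means, while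
`|A|` is at most the maximum of `|P'|`. The pointwise bound comes from writing `zP'/P` as the sum of
`1/(1 - a/z)` over the roots `a`, then perturbing the leading coefficient of `P`. The case `k = 1`
follows by dilating `P` and taking a limit. -/

theorem circleIntegrable_norm_sq {f : ℂ → ℂ} (hf : ContinuousOn f (Metric.closedBall 0 1)) :
    CircleIntegrable (fun z => ‖f z‖ ^ 2) 0 1 :=
  ((hf.mono Metric.sphere_subset_closedBall).norm.pow 2).circleIntegrable zero_le_one

/-- Pythagoras for a holomorphic function vanishing at the centre and a constant. -/
theorem circleAverage_norm_sq_add_const {h : ℂ → ℂ} (hh : DiffContOnCl ℂ h (Metric.ball 0 1))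
    (h0 : h 0 = 0) (a : ℂ) :
    Real.circleAverage (fun z => ‖h z + a‖ ^ 2) 0 1
      = Real.circleAverage (fun z => ‖h z‖ ^ 2) 0 1 + ‖a‖ ^ 2 := by
  have hc : ContinuousOn h (Metric.closedBall 0 1) := hh.continuousOn_ball
  -- The cross term in `|h + a|²` is the real part of this function, so its mean is its value at the
  -- centre, namely 0.
  have hg : DiffContOnCl ℂ (fun z => (2 * starRingEnd ℂ a) • h z) (Metric.ball 0 |1|) := by
    rw [abs_one]; exact hh.const_smul (2 * starRingEnd ℂ a)
  have hgi : CircleIntegrable (fun z => (2 * starRingEnd ℂ a) • h z) 0 1 :=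
    ContinuousOn.circleIntegrable zero_le_one
      ((hc.mono Metric.sphere_subset_closedBall).const_smul (2 * starRingEnd ℂ a))
  have hre : Real.circleAverage (fun z => ((2 * starRingEnd ℂ a) • h z).re) 0 1 = 0 := by
    have h1 := Complex.reCLM.circleAverage_comp_comm hgi
    rw [hg.circleAverage, h0] at h1
    simpa [Function.comp_def] using h1
  have hrei : CircleIntegrable (fun z => ((2 * starRingEnd ℂ a) • h z).re) 0 1 :=
    ContinuousOn.circleIntegrable zero_le_one (Complex.continuous_re.comp_continuousOn
      ((hc.mono Metric.sphere_subset_closedBall).const_smul (2 * starRingEnd ℂ a)))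
  have hi := circleIntegrable_norm_sq hc
  have hca : CircleIntegrable (fun _ : ℂ => ‖a‖ ^ 2) 0 1 := circleIntegrable_const _ _ _
  have he : (fun z => ‖h z + a‖ ^ 2)
      = fun z => (‖h z‖ ^ 2 + ((2 * starRingEnd ℂ a) • h z).re) + ‖a‖ ^ 2 := by
    funext z
    simp only [← Complex.normSq_eq_norm_sq, Complex.normSq_apply, smul_eq_mul, Complex.mul_re,
      Complex.mul_im, Complex.add_re, Complex.add_im, Complex.conj_re, Complex.conj_im,
      Complex.re_ofNat, Complex.im_ofNat]
    ring
  have hsum : CircleIntegrable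
      (fun z => ‖h z‖ ^ 2 + ((2 * starRingEnd ℂ a) • h z).re) 0 1 := hi.add hrei
  rw [he, Real.circleAverage_fun_add hsum hca, Real.circleAverage_fun_add hi hrei, hre,
    Real.circleAverage_const, add_zero]

/-- Littlewood's subordination inequality in `H²` for polynomials. -/
theorem circleAverage_norm_sq_eval_comp_le {φ : ℂ → ℂ}
    (hφ : DiffContOnCl ℂ φ (Metric.ball 0 1)) (h0 : φ 0 = 0)
    (hb : ∀ z ∈ Metric.sphere (0 : ℂ) 1, ‖φ z‖ ≤ 1) (q : ℂ[X]) :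
    Real.circleAverage (fun z => ‖q.eval (φ z)‖ ^ 2) 0 1
      ≤ Real.circleAverage (fun z => ‖q.eval z‖ ^ 2) 0 1 := by
  have hcomp (r : ℂ[X]) {ψ : ℂ → ℂ} (hψ : DiffContOnCl ℂ ψ (Metric.ball 0 1)) :
      DiffContOnCl ℂ (fun z => r.eval (ψ z)) (Metric.ball 0 1) :=
    r.differentiable.comp_diffContOnCl hψ
  have hsub (r : ℂ[X]) (a : ℂ) {ψ : ℂ → ℂ} (hψ : DiffContOnCl ℂ ψ (Metric.ball 0 1))
      (hψ0 : ψ 0 = 0) :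
      Real.circleAverage (fun z => ‖(r * X + C a).eval (ψ z)‖ ^ 2) 0 1
        = Real.circleAverage (fun z => ‖(r * X).eval (ψ z)‖ ^ 2) 0 1 + ‖a‖ ^ 2 := by
    simpa only [eval_add, eval_C] using
      circleAverage_norm_sq_add_const (hcomp (r * X) hψ) (by simp [hψ0]) a
  have hid : DiffContOnCl ℂ (fun z : ℂ => z) (Metric.ball 0 1) := differentiable_id.diffContOnCl
  suffices ∀ (N : ℕ) (q : ℂ[X]), q.natDegree ≤ N →
      Real.circleAverage (fun z => ‖q.eval (φ z)‖ ^ 2) 0 1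
        ≤ Real.circleAverage (fun z => ‖q.eval z‖ ^ 2) 0 1 from this _ q le_rfl
  intro N
  induction N with
  | zero =>
    intro q hq
    rw [eq_C_of_natDegree_le_zero hq]
    simp
  | succ N ih =>
    intro q hq
    have hd : q.divX.natDegree ≤ N := by rw [natDegree_divX_eq_natDegree_tsub_one]; omega
    -- With `q = rX + a`, Pythagoras splits off `|a|²` on both sides. Multiplying `r(φ)` by `φ`
    -- cannot increase the mean and multiplying `r` by `z` preserves it, so the claim reduces to
    -- `r`.
    rw [← divX_mul_X_add q, hsub _ _ hφ h0, hsub _ _ hid rfl]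
    have h1 : Real.circleAverage (fun z => ‖(q.divX * X).eval (φ z)‖ ^ 2) 0 1
        ≤ Real.circleAverage (fun z => ‖q.divX.eval (φ z)‖ ^ 2) 0 1 := by
      refine Real.circleAverage_mono
        (circleIntegrable_norm_sq (hcomp (q.divX * X) hφ).continuousOn_ball)
        (circleIntegrable_norm_sq (hcomp q.divX hφ).continuousOn_ball) fun z hz => ?_
      rw [abs_one] at hz
      rw [eval_mul, eval_X, norm_mul]
      gcongr
      exact mul_le_of_le_one_right (norm_nonneg _) (hb z hz)
    have h2 : Real.circleAverage (fun z => ‖(q.divX * X).eval z‖ ^ 2) 0 1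
        = Real.circleAverage (fun z => ‖q.divX.eval z‖ ^ 2) 0 1 := by
      refine Real.circleAverage_congr_sphere fun z hz => ?_
      have : ‖z‖ = 1 := by simpa using hz
      simp [this]
    linarith [ih _ hd]

/-- Littlewood's subordination inequality in `H²` for uniform limits of polynomials. -/
theorem circleAverage_norm_sq_comp_le {φ : ℂ → ℂ}
    (hφ : DiffContOnCl ℂ φ (Metric.ball 0 1)) (h0 : φ 0 = 0)
    (hb : ∀ z ∈ Metric.closedBall (0 : ℂ) 1, ‖φ z‖ ≤ 1) {g : ℂ → ℂ}
    (hg : ContinuousOn g (Metric.closedBall 0 1))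
    (happ : ∀ ε > 0, ∃ q : ℂ[X], ∀ z ∈ Metric.closedBall (0 : ℂ) 1, ‖g z - q.eval z‖ < ε) :
    Real.circleAverage (fun z => ‖g (φ z)‖ ^ 2) 0 1
      ≤ Real.circleAverage (fun z => ‖g z‖ ^ 2) 0 1 := by
  obtain ⟨B, hB⟩ := (isCompact_closedBall (0 : ℂ) 1).exists_bound_of_continuousOn hg
  have hB0 : 0 ≤ B := (norm_nonneg _).trans (hB 0 (by simp))
  have hmaps : Set.MapsTo φ (Metric.closedBall 0 1) (Metric.closedBall 0 1) :=
    fun z hz => by simpa using hb z hz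
  have hφc : ContinuousOn φ (Metric.closedBall 0 1) := hφ.continuousOn_ball
  refine le_of_forall_pos_le_add fun δ hδ => ?_
  -- If `|g| ≤ B` and `|q|` is within `ε ≤ 1` of `|g|`, the squares differ by at most `ε(2B + 1)`.
  obtain ⟨ε, hε0, hε1, hεδ⟩ : ∃ ε : ℝ, 0 < ε ∧ ε ≤ 1 ∧ ε * (2 * B + 1) ≤ δ / 2 := by
    refine ⟨min 1 (δ / 2 / (2 * B + 1)), by positivity, min_le_left _ _, ?_⟩
    rw [← le_div_iff₀ (by positivity)]
    exact min_le_right _ _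
  obtain ⟨q, hq⟩ := happ ε hε0
  have hkey (z : ℂ) (hz : z ∈ Metric.closedBall (0 : ℂ) 1) :
      ‖g z‖ ^ 2 ≤ ‖q.eval z‖ ^ 2 + δ / 2 ∧ ‖q.eval z‖ ^ 2 ≤ ‖g z‖ ^ 2 + δ / 2 := by
    have h1 := hq z hz
    have h2 := hB z hz
    have h3 : ‖g z‖ ≤ ‖q.eval z‖ + ε := by
      linarith [norm_sub_norm_le (g z) (q.eval z)]
    have h4 : ‖q.eval z‖ ≤ ‖g z‖ + ε := by
      linarith [norm_sub_norm_le (q.eval z) (g z), norm_sub_rev (g z) (q.eval z)]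
    have h5 := norm_nonneg (g z)
    have h6 := norm_nonneg (q.eval z)
    constructor <;> nlinarith
  have hgi : CircleIntegrable (fun z => ‖g z‖ ^ 2) 0 1 := circleIntegrable_norm_sq hg
  have hgφi : CircleIntegrable (fun z => ‖g (φ z)‖ ^ 2) 0 1 :=
    circleIntegrable_norm_sq (hg.comp hφc hmaps)
  have hqi : CircleIntegrable (fun z => ‖q.eval z‖ ^ 2) 0 1 :=
    circleIntegrable_norm_sq q.continuous.continuousOn
  have hqφi : CircleIntegrable (fun z => ‖q.eval (φ z)‖ ^ 2) 0 1 :=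
    circleIntegrable_norm_sq (q.continuous.comp_continuousOn hφc)
  have hci : CircleIntegrable (fun _ : ℂ => δ / 2) 0 1 := circleIntegrable_const _ _ _
  have hsph : Metric.sphere (0 : ℂ) |1| ⊆ Metric.closedBall 0 1 := by
    rw [abs_one]; exact Metric.sphere_subset_closedBall
  have h1 : Real.circleAverage (fun z => ‖g (φ z)‖ ^ 2) 0 1
      ≤ Real.circleAverage (fun z => ‖q.eval (φ z)‖ ^ 2) 0 1 + δ / 2 := by
    rw [← Real.circleAverage_const (δ / 2) 0 1, ← Real.circleAverage_fun_add hqφi hci]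
    exact Real.circleAverage_mono hgφi (hqφi.add hci) fun z hz => (hkey _ (hmaps (hsph hz))).1
  have h2 : Real.circleAverage (fun z => ‖q.eval z‖ ^ 2) 0 1
      ≤ Real.circleAverage (fun z => ‖g z‖ ^ 2) 0 1 + δ / 2 := by
    rw [← Real.circleAverage_const (δ / 2) 0 1, ← Real.circleAverage_fun_add hgi hci]
    exact Real.circleAverage_mono hqi (hgi.add hci) fun z hz => (hkey _ (hsph hz)).2
  have h3 := circleAverage_norm_sq_eval_comp_le hφ h0
    (fun z hz => hb z (Metric.sphere_subset_closedBall hz)) q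
  linarith

/-- On smaller discs the binomial series approximates `(1 + y) ^ a` uniformly. -/
theorem exists_polynomial_near_one_add_cpow (a : ℂ) {k : ℝ} (hk0 : 0 ≤ k) (hk1 : k < 1) {ε : ℝ}
    (hε : 0 < ε) : ∃ q : ℂ[X], ∀ y : ℂ, ‖y‖ ≤ k → ‖(1 + y) ^ a - q.eval y‖ < ε := by
  obtain ⟨r, hkr, hr1⟩ := exists_between hk1
  lift r to NNReal using hk0.trans hkr.le
  have hs := (Complex.one_add_cpow_hasFPowerSeriesOnBall_zero (a := a)).tendstoUniformlyOn'
    (r' := r) (by exact_mod_cast hr1)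
  obtain ⟨N, hN⟩ := (Metric.tendstoUniformlyOn_iff.1 hs ε hε).exists
  refine ⟨∑ i ∈ Finset.range N, C ((binomialSeries ℂ a).coeff i) * X ^ i, fun y hy => ?_⟩
  have := hN y (by simpa using hy.trans_lt hkr)
  rw [dist_eq_norm] at this
  simpa only [FormalMultilinearSeries.partialSum, eval_finsetSum, eval_mul, eval_C, eval_pow,
    eval_X, sub_zero, FormalMultilinearSeries.apply_eq_pow_smul_coeff, smul_eq_mul,
    mul_comm (y ^ _)] using this

/-- For `k < 1` the values `1 + kz` avoid the branch cut, so `(1 + kz)^(p/2)` is a uniform limit of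
polynomials. Its squared modulus is `|1 + kz|^p`, which reduces every real exponent to the `H²`
case. -/
theorem circleAverage_norm_one_add_mul_rpow_le {φ : ℂ → ℂ}
    (hφ : DiffContOnCl ℂ φ (Metric.ball 0 1)) (h0 : φ 0 = 0)
    (hb : ∀ z ∈ Metric.closedBall (0 : ℂ) 1, ‖φ z‖ ≤ 1) {k : ℝ} (hk0 : 0 ≤ k) (hk1 : k < 1)
    (p : ℝ) :
    Real.circleAverage (fun z => ‖1 + k * φ z‖ ^ p) 0 1
      ≤ Real.circleAverage (fun z => ‖1 + (k : ℂ) * z‖ ^ p) 0 1 := by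
  have hkz (z : ℂ) (hz : z ∈ Metric.closedBall (0 : ℂ) 1) : ‖(k : ℂ) * z‖ ≤ k := by
    rw [norm_mul, Complex.norm_real, Real.norm_of_nonneg hk0]
    exact mul_le_of_le_one_right hk0 (by simpa using hz)
  have hslit (z : ℂ) (hz : z ∈ Metric.closedBall (0 : ℂ) 1) :
      1 + (k : ℂ) * z ∈ Complex.slitPlane :=
    Complex.mem_slitPlane_of_norm_lt_one ((hkz z hz).trans_lt hk1)
  have hsq (w : ℂ) : ‖w ^ ((p / 2 : ℝ) : ℂ)‖ ^ 2 = ‖w‖ ^ p := by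
    rw [Complex.norm_cpow_real, ← Real.rpow_natCast, ← Real.rpow_mul (norm_nonneg _)]
    congr 1
    push_cast
    ring
  have := circleAverage_norm_sq_comp_le (g := fun z => (1 + (k : ℂ) * z) ^ ((p / 2 : ℝ) : ℂ))
    hφ h0 hb (ContinuousOn.cpow (by fun_prop) (by fun_prop) hslit) fun ε hε => by
      obtain ⟨q, hq⟩ := exists_polynomial_near_one_add_cpow ((p / 2 : ℝ) : ℂ) hk0 hk1 hε
      exact ⟨q.comp (C (k : ℂ) * X), fun z hz => by simpa using hq _ (hkz z hz)⟩
  simpa only [hsq] using this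

/-! ### Polynomials with all zeros in a disc -/

theorem eval_reflect {K : Type*} [Field K] {f : K[X]} {N : ℕ} (hf : f.natDegree ≤ N) {z : K}
    (hz : z ≠ 0) : (reflect N f).eval z = z ^ N * f.eval z⁻¹ := by
  let _ : Invertible z⁻¹ := invertibleOfNonzero (inv_ne_zero hz)
  have h := eval₂_reflect_mul_pow (RingHom.id K) z⁻¹ N f hf
  rw [invOf_eq_inv, inv_inv, eval₂_id, eval₂_id] at h
  rw [← h, inv_pow]
  field_simp

/-- If `‖u‖ ≤ k < 1`, then `1 / (1 - u)` lies in the disc with diameter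
`[1 / (1 + k), 1 / (1 - k)]`. -/
theorem norm_mul_inv_one_sub_sub_one_le {k : ℝ} (hk0 : 0 ≤ k) (hk1 : k < 1) {u : ℂ}
    (hu : ‖u‖ ≤ k) : ‖((1 - k ^ 2 : ℝ) : ℂ) * (1 / (1 - u)) - 1‖ ≤ k := by
  have hne : 1 - u ≠ 0 := by
    intro h
    rw [← sub_eq_zero.1 h, norm_one] at hu
    linarith
  have hpos : 0 < ‖1 - u‖ := norm_pos_iff.2 hne
  have he : ((1 - k ^ 2 : ℝ) : ℂ) * (1 / (1 - u)) - 1 = (u - (k ^ 2 : ℝ)) / (1 - u) := by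
    field_simp
    push_cast
    ring
  rw [he, norm_div, div_le_iff₀ hpos]
  refine abs_le_of_sq_le_sq' ?_ (by positivity) |>.2
  -- After squaring, the terms in `Re u` cancel, leaving `(1 - k²)|u|² ≤ (1 - k²)k²`.
  have h1 : ‖u‖ ^ 2 ≤ k ^ 2 := by gcongr
  have hk2 : 0 ≤ 1 - k ^ 2 := by nlinarith
  rw [mul_pow]
  simp only [← Complex.normSq_eq_norm_sq, Complex.normSq_apply, Complex.sub_re, Complex.sub_im,
    Complex.ofReal_re, Complex.ofReal_im, Complex.one_re, Complex.one_im] at h1 ⊢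
  nlinarith [mul_le_mul_of_nonneg_left h1 hk2]

/-- If all zeros of `Q` lie in `‖z‖ ≤ k < 1`, then on the unit circle the derivative of the
reciprocal polynomial is at most `k` times the derivative of `Q` in modulus. -/
theorem norm_natDegree_mul_eval_sub_le {Q : ℂ[X]} {k : ℝ} (hk0 : 0 ≤ k) (hk1 : k < 1)
    (hQ : ∀ z : ℂ, Q.eval z = 0 → ‖z‖ ≤ k) {z : ℂ} (hz : ‖z‖ = 1) :
    ‖(Q.natDegree : ℂ) * Q.eval z - z * (derivative Q).eval z‖
      ≤ k * ‖(derivative Q).eval z‖ := by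
  have hz0 : z ≠ 0 := norm_pos_iff.1 (by rw [hz]; exact one_pos)
  have hQz : Q.eval z ≠ 0 := fun h => by linarith [hQ z h]
  have hQ0 : Q ≠ 0 := by rintro rfl; simp at hQz
  have hsp : Q.Splits := IsAlgClosed.splits Q
  set S : ℂ := (Q.roots.map fun a => 1 / (1 - a / z)).sum with hS
  have hder : z * (derivative Q).eval z = Q.eval z * S := by
    rw [hsp.eval_derivative_eq_eval_mul_sum hQz, hS, mul_left_comm, ← Multiset.sum_map_mul_left]
    congr 2
    refine Multiset.map_congr rfl fun a ha => ?_
    have hza : z - a ≠ 0 := fun h => hQz (by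
      rw [sub_eq_zero.1 h]; exact (mem_roots hQ0).1 ha)
    have : 1 - a / z ≠ 0 := by
      rw [one_sub_div hz0]; exact div_ne_zero hza hz0
    field_simp
  have hsum (s : Multiset ℂ) (hs : ∀ a ∈ s, ‖a‖ ≤ k) :
      ‖((1 - k ^ 2 : ℝ) : ℂ) * (s.map fun a => 1 / (1 - a / z)).sum - (s.card : ℂ)‖
        ≤ s.card * k := by
    induction s using Multiset.induction_on with
    | empty => simp
    | cons a s ih =>
      have h1 := ih fun b hb => hs b (Multiset.mem_cons_of_mem hb)
      have h2 := norm_mul_inv_one_sub_sub_one_le (u := a / z) hk0 hk1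
        (by rw [norm_div, hz, div_one]; exact hs a (Multiset.mem_cons_self a s))
      rw [Multiset.map_cons, Multiset.sum_cons, Multiset.card_cons]
      push_cast at h1 h2 ⊢
      calc _ = ‖((1 - (k : ℂ) ^ 2) * (1 / (1 - a / z)) - 1)
            + ((1 - (k : ℂ) ^ 2) * (s.map fun a => 1 / (1 - a / z)).sum - (s.card : ℂ))‖ := by
              congr 1; ring
        _ ≤ k + s.card * k := (norm_add_le _ _).trans (add_le_add h2 h1)
        _ = _ := by ring
  have hcard := hsum Q.roots fun a ha => hQ a ((mem_roots hQ0).1 ha)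
  rw [← hS, ← hsp.natDegree_eq_card_roots] at hcard
  -- An Apollonius disc: `|n - S| ≤ k|S|` and `|(1 - k²)S - n| ≤ nk` describe the same set, their
  -- squared forms differing by the factor `1 - k²`.
  have hmain : ‖(Q.natDegree : ℂ) - S‖ ≤ k * ‖S‖ := by
    have hk2 : 0 < 1 - k ^ 2 := by nlinarith
    refine abs_le_of_sq_le_sq' ?_ (by positivity) |>.2
    have h1 := pow_le_pow_left₀ (norm_nonneg _) hcard 2
    rw [mul_pow] at h1 ⊢
    simp only [← Complex.normSq_eq_norm_sq, Complex.normSq_apply, Complex.sub_re, Complex.sub_im,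
      Complex.mul_re, Complex.mul_im, Complex.natCast_re, Complex.natCast_im,
      Complex.ofReal_re, Complex.ofReal_im] at h1 ⊢
    refine le_of_mul_le_mul_left ?_ hk2
    nlinarith
  have hP' : ‖(derivative Q).eval z‖ = ‖Q.eval z‖ * ‖S‖ := by
    rw [← norm_mul, ← hder, norm_mul, hz, one_mul]
  rw [hder, hP', mul_comm (Q.natDegree : ℂ), ← mul_sub, norm_mul, mul_left_comm]
  gcongr

theorem minModulus_nonneg (P : ℂ[X]) {r : ℝ} (hr : 0 ≤ r) : 0 ≤ minModulus P r := by
  obtain ⟨z, -, hz⟩ := (minModulus_isLeast P hr).1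
  exact hz ▸ norm_nonneg _

theorem minModulus_le (P : ℂ[X]) {z : ℂ} {r : ℝ} (hz : ‖z‖ = r) : minModulus P r ≤ ‖P.eval z‖ :=
  (minModulus_isLeast P (hz ▸ norm_nonneg z)).2 ⟨z, by simpa using hz, rfl⟩

theorem le_maxModulus (P : ℂ[X]) {z : ℂ} {r : ℝ} (hz : ‖z‖ = r) : ‖P.eval z‖ ≤ maxModulus P r :=
  (maxModulus_isGreatest P (hz ▸ norm_nonneg z)).2 ⟨z, by simpa using hz, rfl⟩

/-- Minimum principle for the reversed polynomial. -/
theorem minModulus_div_pow_le_norm_eval_reverse {P : ℂ[X]} {k : ℝ} (hk0 : 0 < k)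
    (hP : ∀ z : ℂ, P.eval z = 0 → ‖z‖ ≤ k) {w : ℂ} (hw : ‖w‖ ≤ k⁻¹) :
    minModulus P k / k ^ P.natDegree ≤ ‖P.reverse.eval w‖ := by
  rcases (minModulus_nonneg P hk0.le).eq_or_lt with hm | hm
  · rw [← hm, zero_div]; exact norm_nonneg _
  have hP0 : P ≠ 0 := by
    rintro rfl
    have := minModulus_le 0 (z := (k : ℂ)) (r := k) (by simp [hk0.le])
    simp at this
    linarith
  have heval {z : ℂ} (hz : z ≠ 0) : P.reverse.eval z = z ^ P.natDegree * P.eval z⁻¹ :=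
    eval_reflect le_rfl hz
  have hne (z : ℂ) (hz : z ∈ Metric.closedBall (0 : ℂ) k⁻¹) : P.reverse.eval z ≠ 0 := by
    rcases eq_or_ne z 0 with rfl | hz0
    · rw [← coeff_zero_eq_eval_zero, coeff_zero_reverse]
      exact leadingCoeff_ne_zero.2 hP0
    · rw [heval hz0]
      refine mul_ne_zero (pow_ne_zero _ hz0) fun h => ?_
      -- A root `z⁻¹` of `P` would have modulus exactly `k`, forcing the minimum on that circle to
      -- be 0.
      have hle : k ≤ ‖z⁻¹‖ := by
        rw [norm_inv, le_inv_comm₀ hk0 (norm_pos_iff.2 hz0)]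
        simpa using hz
      have := minModulus_le P ((hP _ h).antisymm hle)
      rw [h, norm_zero] at this
      linarith
  have hd : DiffContOnCl ℂ (fun z => (P.reverse.eval z)⁻¹) (Metric.ball 0 k⁻¹) := by
    refine DiffContOnCl.inv P.reverse.differentiable.diffContOnCl fun z hz => hne z ?_
    rwa [closure_ball _ (inv_pos.2 hk0).ne'] at hz
  have hk' : k⁻¹ ≠ 0 := (inv_pos.2 hk0).ne'
  have hbound : ‖(P.reverse.eval w)⁻¹‖ ≤ (minModulus P k / k ^ P.natDegree)⁻¹ := by
    refine Complex.norm_le_of_forall_mem_frontier_norm_le Metric.isBounded_ball hd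
      (fun z hz => ?_) (by rw [closure_ball _ hk']; simpa using hw)
    rw [frontier_ball _ hk', mem_sphere_zero_iff_norm] at hz
    have hz0 : z ≠ 0 := norm_pos_iff.1 (by rw [hz]; positivity)
    rw [norm_inv]
    refine inv_anti₀ (by positivity) ?_
    rw [heval hz0, norm_mul, norm_pow, hz, inv_pow, div_eq_inv_mul]
    gcongr
    exact minModulus_le P (by rw [norm_inv, hz, inv_inv])
  rw [norm_inv] at hbound
  exact (inv_le_inv₀ (norm_pos_iff.2 (hne w (by simpa using hw))) (by positivity)).1 hbound

theorem minModulus_div_pow_le_norm_leadingCoeff {P : ℂ[X]} {k : ℝ} (hk0 : 0 < k)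
    (hP : ∀ z : ℂ, P.eval z = 0 → ‖z‖ ≤ k) :
    minModulus P k / k ^ P.natDegree ≤ ‖P.leadingCoeff‖ := by
  rw [← coeff_zero_reverse, coeff_zero_eq_eval_zero]
  exact minModulus_div_pow_le_norm_eval_reverse hk0 hP (by simp [hk0.le])

/-- This is the bound on the reversed polynomial read at `1/z`. It prevents `P - μX^n` from
acquiring zeros outside the disc when `|μ|` is small. -/
theorem minModulus_div_pow_mul_norm_pow_le {P : ℂ[X]} {k : ℝ} (hk0 : 0 < k)
    (hP : ∀ z : ℂ, P.eval z = 0 → ‖z‖ ≤ k) {z : ℂ} (hz : k ≤ ‖z‖) :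
    minModulus P k / k ^ P.natDegree * ‖z‖ ^ P.natDegree ≤ ‖P.eval z‖ := by
  have hz0 : z ≠ 0 := norm_pos_iff.1 (hk0.trans_le hz)
  have h := minModulus_div_pow_le_norm_eval_reverse hk0 hP (w := z⁻¹)
    (by rw [norm_inv]; exact inv_anti₀ hk0 hz)
  rw [reverse, eval_reflect le_rfl (inv_ne_zero hz0), inv_inv, norm_mul, inv_pow, norm_inv,
    norm_pow, inv_mul_eq_div, le_div_iff₀ (by positivity)] at h
  exact h

/-- Perturbing the leading coefficient by less than the normalized minimum modulus keeps the zeros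
in the disc, and so gives a perturbed form of `norm_natDegree_mul_eval_sub_le`. -/
theorem norm_natDegree_mul_eval_sub_le_of_perturb {P : ℂ[X]} {k : ℝ} (hk0 : 0 < k) (hk1 : k < 1)
    (hP : ∀ z : ℂ, P.eval z = 0 → ‖z‖ ≤ k) (hn : P.natDegree ≠ 0) {μ : ℂ}
    (hμ : μ = 0 ∨ ‖μ‖ < minModulus P k / k ^ P.natDegree) {z : ℂ} (hz : ‖z‖ = 1) :
    ‖(P.natDegree : ℂ) * P.eval z - z * (derivative P).eval z‖
        ≤ k * ‖(derivative P).eval z - P.natDegree * μ * z ^ (P.natDegree - 1)‖ ∧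
      (derivative P).eval z - P.natDegree * μ * z ^ (P.natDegree - 1) ≠ 0 := by
  set n := P.natDegree with hn_def
  set Q : ℂ[X] := P - C μ * X ^ n with hQ
  have hP0 : P ≠ 0 := by rintro rfl; simp [hn_def] at hn
  have hdeg : Q.natDegree = n := by
    refine natDegree_eq_of_le_of_coeff_ne_zero ?_ ?_
    · exact (natDegree_sub_le _ _).trans (max_le le_rfl (natDegree_C_mul_X_pow_le _ _))
    · rw [hQ, coeff_sub, coeff_C_mul_X_pow, if_pos rfl, sub_ne_zero]
      -- The value `μ = 0` is a separate case because the strict bound admits no `μ` when the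
      -- minimum modulus is 0.
      rcases hμ with rfl | hμ
      · exact leadingCoeff_ne_zero.2 hP0
      · rintro rfl
        exact absurd (minModulus_div_pow_le_norm_leadingCoeff hk0 hP) (not_le.2 hμ)
  have hzeros (w : ℂ) (hw : Q.eval w = 0) : ‖w‖ ≤ k := by
    rcases hμ with rfl | hμ
    · exact hP w (by simpa [hQ] using hw)
    by_contra! hlt
    have h1 := minModulus_div_pow_mul_norm_pow_le hk0 hP hlt.le
    have h2 : P.eval w = μ * w ^ n := by simpa [hQ, sub_eq_zero] using hw
    rw [h2, norm_mul, norm_pow] at h1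
    have h3 : 0 < ‖w‖ ^ n := pow_pos (hk0.trans hlt) n
    exact absurd (le_of_mul_le_mul_right h1 h3) (not_le.2 hμ)
  have hder : (derivative Q).eval z = (derivative P).eval z - n * μ * z ^ (n - 1) := by
    simp only [hQ, derivative_sub, derivative_C_mul_X_pow, eval_sub, eval_mul, eval_C, eval_pow,
      eval_X]
    ring
  have hzn : z * z ^ (n - 1) = z ^ n := mul_pow_sub_one hn z
  have hcomb : (n : ℂ) * Q.eval z - z * (derivative Q).eval z
      = n * P.eval z - z * (derivative P).eval z := by
    rw [hder]
    simp only [hQ, eval_sub, eval_mul, eval_C, eval_pow, eval_X]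
    linear_combination (n : ℂ) * μ * hzn
  have hle := norm_natDegree_mul_eval_sub_le hk0.le hk1 hzeros hz
  rw [hdeg, hcomb, hder] at hle
  -- If `Q'` vanished at `z`, the inequality would give `Q(z) = 0`, but the zeros of `Q` have
  -- modulus at most `k < 1`.
  refine ⟨hle, fun h0 => ?_⟩
  have h1 : (n : ℂ) * Q.eval z - z * (derivative Q).eval z = 0 := by
    rw [hcomb, ← norm_le_zero_iff]
    simpa [h0] using hle
  rw [hder, h0, mul_zero, sub_zero] at h1
  have h2 : Q.eval z = 0 := (mul_eq_zero.1 h1).resolve_left (by exact_mod_cast hn)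
  linarith [hzeros z h2]

/-- Replacing `P` by `P - μz^n` leaves `nP - zP'` unchanged but alters `P'` by `nμz^(n-1)`. Aligning
the argument of this term with that of `P'(z)` lowers `|P'(z)|` by the full `n|μ|`, and `|μ|` then
tends to its bound. -/
theorem norm_natDegree_mul_eval_sub_add_le {P : ℂ[X]} {k : ℝ} (hk0 : 0 < k) (hk1 : k < 1)
    (hP : ∀ z : ℂ, P.eval z = 0 → ‖z‖ ≤ k) (hn : P.natDegree ≠ 0) {z : ℂ} (hz : ‖z‖ = 1) :
    ‖(P.natDegree : ℂ) * P.eval z - z * (derivative P).eval z‖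
        + k * (P.natDegree * (minModulus P k / k ^ P.natDegree))
      ≤ k * ‖(derivative P).eval z‖ := by
  have key := fun μ hμ =>
    norm_natDegree_mul_eval_sub_le_of_perturb hk0 hk1 hP hn (μ := μ) hμ hz
  set n := P.natDegree with hn_def
  set b : ℝ := minModulus P k / k ^ n with hb
  set d : ℂ := (derivative P).eval z with hd
  have hb0 : 0 ≤ b := div_nonneg (minModulus_nonneg P hk0.le) (by positivity)
  have hz0 : z ≠ 0 := norm_pos_iff.1 (by rw [hz]; exact one_pos)
  have hzp : z ^ (n - 1) ≠ 0 := pow_ne_zero _ hz0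
  have hnC : (n : ℂ) ≠ 0 := by exact_mod_cast hn
  have hnpos : (0 : ℝ) < n := by exact_mod_cast Nat.pos_of_ne_zero hn
  have hd0 : d ≠ 0 := by simpa using (key 0 (Or.inl rfl)).2
  have hdpos : 0 < ‖d‖ := norm_pos_iff.2 hd0
  -- Otherwise `μ = d/(nz^(n-1))` would be admissible and would make the perturbed derivative vanish
  -- at `z`.
  have hdb : n * b ≤ ‖d‖ := by
    by_contra! hlt
    refine (key (d / (n * z ^ (n - 1))) (Or.inr ?_)).2 ?_
    · rw [norm_div, norm_mul, norm_pow, hz, one_pow, mul_one, Complex.norm_natCast,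
        div_lt_iff₀ hnpos, mul_comm]
      exact hlt
    · field_simp
      ring
  have hstep (t : ℝ) (ht0 : 0 ≤ t) (ht1 : t < 1) :
      ‖(n : ℂ) * P.eval z - z * d‖ ≤ k * (‖d‖ - n * (t * b)) := by
    have hμn : ‖((t * b : ℝ) : ℂ) * d / (‖d‖ * z ^ (n - 1))‖ = t * b := by
      rw [norm_div, norm_mul, norm_mul, norm_pow, hz, Complex.norm_real, Complex.norm_real,
        norm_norm, Real.norm_of_nonneg (by positivity), one_pow, mul_one]
      field_simp
    refine (key (((t * b : ℝ) : ℂ) * d / (‖d‖ * z ^ (n - 1))) ?_).1.trans_eq ?_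
    · rcases hb0.eq_or_lt with h | h
      · left; rw [← norm_eq_zero, hμn, ← h, mul_zero]
      · right; rw [hμn]; nlinarith
    · have hdC : (‖d‖ : ℂ) ≠ 0 := by exact_mod_cast hdpos.ne'
      have he : d - n * (((t * b : ℝ) : ℂ) * d / (‖d‖ * z ^ (n - 1))) * z ^ (n - 1)
          = d * ((1 - n * (t * b) / ‖d‖ : ℝ) : ℂ) := by
        push_cast
        field_simp
      have h0 : 0 ≤ 1 - n * (t * b) / ‖d‖ := by
        rw [sub_nonneg, div_le_one hdpos]
        refine le_trans ?_ hdb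
        gcongr
        nlinarith
      rw [he, norm_mul, Complex.norm_real, Real.norm_of_nonneg h0]
      field_simp
  have hlim : Filter.Tendsto (fun t : ℝ => k * (‖d‖ - n * (t * b))) (nhdsWithin 1 (Set.Iio 1))
      (nhds (k * (‖d‖ - n * (1 * b)))) :=
    (Continuous.tendsto (by fun_prop) 1).mono_left nhdsWithin_le_nhds
  have hfin := ge_of_tendsto hlim (by
    filter_upwards [Ioo_mem_nhdsLT (zero_lt_one (α := ℝ))] with t ht
    exact hstep t ht.1.le ht.2)
  linarith

/-! ### `L^p` means on the unit circle -/

theorem circleLp_nonneg (p : ℝ) (f : ℂ → ℂ) : 0 ≤ circleLp p f :=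
  Real.rpow_nonneg (intervalIntegral.integral_nonneg (by positivity) fun _ _ => by positivity) _

theorem circleLp_eq_circleAverage (p : ℝ) (f : ℂ → ℂ) :
    circleLp p f = (2 * Real.pi * Real.circleAverage (fun z => ‖f z‖ ^ p) 0 1) ^ (1 / p) := by
  have : (2 * Real.pi) ≠ 0 := by positivity
  rw [Real.circleAverage_def, smul_eq_mul, mul_inv_cancel_left₀ this]
  simp [circleLp, circleMap]

theorem circleLp_const_mul {p : ℝ} (hp : 0 < p) (a : ℂ) (f : ℂ → ℂ) :
    circleLp p (fun z => a * f z) = ‖a‖ * circleLp p f := by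
  have h0 : 0 ≤ ∫ θ in (0 : ℝ)..2 * Real.pi, ‖f (Complex.exp (θ * Complex.I))‖ ^ p :=
    intervalIntegral.integral_nonneg (by positivity) fun _ _ => by positivity
  simp only [circleLp, norm_mul, Real.mul_rpow (norm_nonneg _) (norm_nonneg _),
    intervalIntegral.integral_const_mul]
  rw [Real.mul_rpow (by positivity) h0, ← Real.rpow_mul (norm_nonneg a),
    mul_one_div_cancel hp.ne', Real.rpow_one]

theorem circleLp_le_circleLp {p : ℝ} (hp : 0 < p) {f g : ℂ → ℂ}
    (h : Real.circleAverage (fun z => ‖f z‖ ^ p) 0 1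
      ≤ Real.circleAverage (fun z => ‖g z‖ ^ p) 0 1) : circleLp p f ≤ circleLp p g := by
  rw [circleLp_eq_circleAverage, circleLp_eq_circleAverage]
  have : 0 ≤ Real.circleAverage (fun z => ‖f z‖ ^ p) 0 1 :=
    Real.circleAverage_nonneg_of_nonneg fun _ _ => by positivity
  gcongr

theorem continuous_circleLp {p : ℝ} (hp : 0 < p) {F : ℝ → ℂ → ℂ}
    (hF : Continuous fun x : ℝ × ℂ => F x.1 x.2) : Continuous fun t => circleLp p (F t) := by
  refine Continuous.rpow_const ?_ fun _ => Or.inr (by positivity)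
  refine intervalIntegral.continuous_parametric_intervalIntegral_of_continuous' ?_ _ _
  have h : Continuous fun x : ℝ × ℝ => F x.1 (Complex.exp (x.2 * Complex.I)) :=
    hF.comp (f := fun x : ℝ × ℝ => (x.1, Complex.exp (x.2 * Complex.I))) (by fun_prop)
  exact h.norm.rpow_const fun _ => Or.inr hp.le

/-! ### The inequality for zeros in an open disc, and the limit -/

theorem natDegree_mul_circleLp_le {P : ℂ[X]} {k : ℝ} (hk0 : 0 < k) (hk1 : k < 1)
    (hP : ∀ z : ℂ, P.eval z = 0 → ‖z‖ ≤ k) (hn : P.natDegree ≠ 0) {c : ℂ}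
    (hc : ‖c‖ ≤ k * (minModulus P k / k ^ P.natDegree)) {p : ℝ} (hp : 0 < p) :
    P.natDegree * circleLp p (fun z => P.eval z + c)
      ≤ circleLp p (fun z => 1 + (k : ℂ) * z) * maxModulus (derivative P) 1 := by
  have hP0 : P ≠ 0 := by rintro rfl; simp at hn
  have key := fun (z : ℂ) (hz : ‖z‖ = 1) =>
    norm_natDegree_mul_eval_sub_add_le hk0 hk1 hP hn hz
  -- Gauss–Lucas: the zeros of `P'` stay in the disc of radius `k < 1`.
  have hder0 : ∀ z : ℂ, 1 ≤ ‖z‖ → (derivative P).eval z ≠ 0 := fun z hz h => by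
    have h1 : z ∈ convexHull ℝ (P.rootSet ℂ) := by
      refine rootSet_derivative_subset_convexHull_rootSet ?_ ?_
      · exact natDegree_pos_iff_degree_pos.1 (Nat.pos_of_ne_zero hn)
      · exact mem_rootSet.2 ⟨fun h' => hn (derivative_eq_zero.1 h'), by simpa using h⟩
    have h2 : convexHull ℝ (P.rootSet ℂ) ⊆ Metric.closedBall 0 k :=
      convexHull_min (fun w hw => by simpa using hP w (by simpa using (mem_rootSet.1 hw).2))
        (convex_closedBall 0 k)
    have := h2 h1
    rw [mem_closedBall_zero_iff] at this
    linarith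
  set n := P.natDegree with hn_def
  set M := maxModulus (derivative P) 1
  have hM0 : 0 ≤ M := (norm_nonneg _).trans (le_maxModulus (derivative P) norm_one)
  set A : ℂ[X] := X * derivative P with hA
  set B : ℂ[X] := C (n : ℂ) * (P + C c) - A with hB
  have hAdeg : A.natDegree ≤ n := by
    refine natDegree_mul_le.trans ?_
    have := natDegree_derivative_le P
    rw [natDegree_X]
    omega
  have hBdeg : B.natDegree ≤ n := by
    refine (natDegree_sub_le _ _).trans (max_le ?_ hAdeg)
    exact (natDegree_C_mul_le _ _).trans (by rw [natDegree_add_C])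
  have hAn : A.coeff n = n * P.coeff n := by
    obtain ⟨j, hj⟩ := Nat.exists_eq_succ_of_ne_zero hn
    rw [hA, hj, coeff_X_mul, coeff_derivative]
    push_cast
    ring
  -- The constant `c` does not reach degree `n` since `n ≠ 0`. This cancellation is what gives `φ(0)
  -- = 0`.
  have hBn : B.coeff n = 0 := by
    rw [hB, coeff_sub, hAn, coeff_C_mul, coeff_add, coeff_C_of_ne_zero hn]
    ring
  have hD0 : ∀ z ∈ Metric.closedBall (0 : ℂ) 1, (reflect n A).eval z ≠ 0 := by
    intro z hz
    rcases eq_or_ne z 0 with rfl | hz0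
    · rw [← coeff_zero_eq_eval_zero, coeff_reflect, revAt_zero, hAn]
      exact mul_ne_zero (by exact_mod_cast hn) (leadingCoeff_ne_zero.2 hP0)
    · rw [eval_reflect hAdeg hz0, hA, eval_mul, eval_X]
      refine mul_ne_zero (pow_ne_zero _ hz0) (mul_ne_zero (inv_ne_zero hz0) (hder0 _ ?_))
      rw [norm_inv]
      exact (one_le_inv₀ (norm_pos_iff.2 hz0)).2 (by simpa using hz)
  set φ : ℂ → ℂ := fun z => (reflect n B).eval z / (k * (reflect n A).eval z) with hφ
  have hkC : (k : ℂ) ≠ 0 := by exact_mod_cast hk0.ne'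
  have hφd : DiffContOnCl ℂ φ (Metric.ball 0 1) := by
    refine DifferentiableOn.diffContOnCl fun z hz => ?_
    rw [closure_ball _ one_ne_zero] at hz
    exact ((reflect n B).differentiable.differentiableAt.fun_div
      ((reflect n A).differentiable.differentiableAt.const_mul (k : ℂ))
      (mul_ne_zero hkC (hD0 z hz))).differentiableWithinAt
  have hφ0 : φ 0 = 0 := by
    simp only [hφ, ← coeff_zero_eq_eval_zero, coeff_reflect, revAt_zero, hBn, zero_div]
  have hφz {z : ℂ} (hz : ‖z‖ = 1) : φ z⁻¹ = B.eval z / (k * A.eval z) := by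
    have hz0 : z ≠ 0 := norm_pos_iff.1 (by rw [hz]; exact one_pos)
    simp only [hφ]
    rw [eval_reflect hBdeg (inv_ne_zero hz0), eval_reflect hAdeg (inv_ne_zero hz0), inv_inv,
      mul_left_comm, mul_div_mul_left _ _ (pow_ne_zero _ (inv_ne_zero hz0))]
  have hAz {z : ℂ} (hz : ‖z‖ = 1) : A.eval z ≠ 0 := by
    rw [hA, eval_mul, eval_X]
    exact mul_ne_zero (norm_pos_iff.1 (by rw [hz]; exact one_pos)) (hder0 z hz.ge)
  have hφs {z : ℂ} (hz : ‖z‖ = 1) : ‖φ z⁻¹‖ ≤ 1 := by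
    rw [hφz hz, norm_div, norm_mul, Complex.norm_real, Real.norm_of_nonneg hk0.le]
    refine div_le_one_of_le₀ ?_ (by positivity)
    have h1 : B.eval z = (n * P.eval z - z * (derivative P).eval z) + n * c := by
      simp [hB, hA]; ring
    have h2 : ‖A.eval z‖ = ‖(derivative P).eval z‖ := by simp [hA, hz]
    rw [h1, h2]
    refine (norm_add_le _ _).trans (le_trans ?_ (key z hz))
    rw [norm_mul, Complex.norm_natCast, mul_left_comm k]
    gcongr
  have hφb : ∀ z ∈ Metric.closedBall (0 : ℂ) 1, ‖φ z‖ ≤ 1 := by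
    intro z hz
    refine Complex.norm_le_of_forall_mem_frontier_norm_le Metric.isBounded_ball hφd
      (fun w hw => ?_) (by rwa [closure_ball _ one_ne_zero])
    rw [frontier_ball _ one_ne_zero, mem_sphere_zero_iff_norm] at hw
    simpa using hφs (z := w⁻¹) (by rw [norm_inv, hw, inv_one])
  have hsub := circleAverage_norm_one_add_mul_rpow_le hφd hφ0 hφb hk0.le hk1 p
  have hφc : ContinuousOn φ (Metric.sphere 0 1) :=
    hφd.continuousOn_ball.mono Metric.sphere_subset_closedBall
  have hinv : ContinuousOn (fun z : ℂ => φ z⁻¹) (Metric.sphere 0 1) := by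
    refine hφc.comp (continuousOn_inv₀.mono fun z hz => ?_) fun z hz => ?_
    · exact ne_zero_of_mem_unit_sphere ⟨z, hz⟩
    · simpa using hz
  have hpoint (z : ℂ) (hz : ‖z‖ = 1) :
      ‖(n : ℂ) * (P.eval z + c)‖ ^ p ≤ M ^ p * ‖1 + k * φ z⁻¹‖ ^ p := by
    have h1 : (n : ℂ) * (P.eval z + c) = A.eval z * (1 + k * φ z⁻¹) := by
      rw [hφz hz]
      have := hAz hz
      field_simp
      simp [hB]
    have h2 : ‖A.eval z‖ ≤ M := by
      simpa [hA, hz] using le_maxModulus (derivative P) hz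
    rw [h1, norm_mul, ← Real.mul_rpow hM0 (norm_nonneg _)]
    gcongr
  have havg : Real.circleAverage (fun z => ‖(n : ℂ) * (P.eval z + c)‖ ^ p) 0 1
      ≤ Real.circleAverage (fun z => ‖(M : ℂ) * (1 + k * z)‖ ^ p) 0 1 := by
    calc _ ≤ Real.circleAverage (fun z => M ^ p * ‖1 + k * φ z⁻¹‖ ^ p) 0 1 := by
          refine Real.circleAverage_mono (ContinuousOn.circleIntegrable zero_le_one ?_)
            (ContinuousOn.circleIntegrable zero_le_one ?_) fun z hz => hpoint z (by simpa using hz)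
          · exact (ContinuousOn.norm (by fun_prop)).rpow_const fun _ _ => Or.inr hp.le
          · exact continuousOn_const.mul ((continuousOn_const.add
              (continuousOn_const.mul hinv)).norm.rpow_const fun _ _ => Or.inr hp.le)
      -- The inversion `z ↦ 1/z` preserves means over the unit circle.
      _ = M ^ p * Real.circleAverage (fun z => ‖1 + k * φ z‖ ^ p) 0 1 := by
          have h1 : Real.circleAverage (fun z => M ^ p * ‖1 + k * φ z⁻¹‖ ^ p) 0 1
              = M ^ p * Real.circleAverage (fun z => ‖1 + k * φ z⁻¹‖ ^ p) 0 1 :=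
            Real.circleAverage_fun_smul (a := M ^ p)
          rw [h1, Real.circleAverage_zero_one_congr_inv (f := fun z => ‖1 + k * φ z‖ ^ p)]
      _ ≤ M ^ p * Real.circleAverage (fun z => ‖1 + (k : ℂ) * z‖ ^ p) 0 1 := by gcongr
      _ = _ := by
          rw [← smul_eq_mul, ← Real.circleAverage_fun_smul]
          simp only [norm_mul, Complex.norm_real, Real.norm_of_nonneg hM0, smul_eq_mul,
            Real.mul_rpow hM0 (norm_nonneg _)]
  have hfin := circleLp_le_circleLp hp havg
  rwa [circleLp_const_mul hp, circleLp_const_mul hp, Complex.norm_natCast, Complex.norm_real,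
    Real.norm_of_nonneg hM0, mul_comm M] at hfin

theorem minModulus_comp_C_mul_X (P : ℂ[X]) {s : ℝ} (hs : 0 < s) (r : ℝ) :
    minModulus (P.comp (C (s : ℂ) * X)) r = minModulus P (s * r) := by
  have hsC : (s : ℂ) ≠ 0 := by exact_mod_cast hs.ne'
  unfold minModulus
  congr 1
  ext x
  simp only [Set.mem_image, mem_sphere_zero_iff_norm, eval_comp, eval_mul, eval_C, eval_X]
  constructor
  · rintro ⟨z, hz, rfl⟩
    exact ⟨s * z, by simp [hz, abs_of_pos hs], rfl⟩
  · rintro ⟨z, hz, rfl⟩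
    refine ⟨z / s, ?_, by rw [mul_div_cancel₀ _ hsC]⟩
    rw [norm_div, hz, Complex.norm_real, Real.norm_of_nonneg hs.le, mul_div_cancel_left₀ _ hs.ne']

theorem continuous_maxModulus {Q : ℝ → ℂ[X]} (hQ : Continuous fun x : ℝ × ℂ => (Q x.1).eval x.2)
    (r : ℝ) : Continuous fun t => maxModulus (Q t) r :=
  (isCompact_sphere (0 : ℂ) r).continuous_sSup (f := fun t z => ‖(Q t).eval z‖) hQ.norm

theorem corollary2 (n : ℕ) (P : ℂ[X]) (hdeg : P.degree = (n : WithBot ℕ))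
    (k : ℝ) (hk0 : 0 < k) (hk1 : k ≤ 1)
    (hzeros : ∀ z : ℂ, P.eval z = 0 → ‖z‖ ≤ k)
    (β : ℂ) (hβ : ‖β‖ ≤ 1) (p : ℝ) (hp : 0 < p) :
    (n : ℝ) * circleLp p (fun z => P.eval z +
        (minModulus P k : ℂ) * β / (k : ℂ) ^ ((n : ℤ) - 1))
      ≤ circleLp p (fun z => 1 + (k : ℂ) * z) * maxModulus (derivative P) 1 := by
  have hnat : P.natDegree = n := natDegree_eq_of_degree_eq_some hdeg
  rcases eq_or_ne n 0 with rfl | hn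
  · rw [Nat.cast_zero, zero_mul]
    exact mul_nonneg (circleLp_nonneg _ _)
      ((norm_nonneg _).trans (le_maxModulus (derivative P) norm_one))
  -- The integer exponent is `-1` only for `n = 0`, already settled; for `n ≥ 1` natural subtraction
  -- agrees with it.
  have hpow : (k : ℂ) ^ ((n : ℤ) - 1) = (k : ℂ) ^ (n - 1) := by
    rw [← zpow_natCast, Nat.cast_sub (Nat.pos_of_ne_zero hn), Nat.cast_one]
  set m := minModulus P k with hm
  have hm0 : 0 ≤ m := minModulus_nonneg P hk0.le
  -- For `t > 0`, `P(e^t z)` has its zeros in the disc of radius `ke^(-t) < 1`, and its minimum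
  -- modulus on that circle is still `m`. Accordingly `c t` is `mβ/(ke^(-t))^(n-1)`.
  let Pt : ℝ → ℂ[X] := fun t => P.comp (C ((Real.exp t : ℝ) : ℂ) * X)
  let c : ℝ → ℂ := fun t => m * β / (k : ℂ) ^ (n - 1) * ((Real.exp t : ℝ) : ℂ) ^ (n - 1)
  have hPt (t : ℝ) (z : ℂ) : (Pt t).eval z = P.eval (((Real.exp t : ℝ) : ℂ) * z) := by
    simp [Pt]
  have hPt' (t : ℝ) (z : ℂ) : (derivative (Pt t)).eval z
      = ((Real.exp t : ℝ) : ℂ) * (derivative P).eval (((Real.exp t : ℝ) : ℂ) * z) := by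
    simp only [Pt, derivative_comp, derivative_C_mul, derivative_X, mul_one, eval_mul, eval_C,
      eval_comp, eval_X]
  have hexp : Continuous fun x : ℝ × ℂ => ((Real.exp x.1 : ℝ) : ℂ) := by fun_prop
  have hineq (t : ℝ) (ht : 0 < t) :
      n * circleLp p (fun z => (Pt t).eval z + c t)
        ≤ circleLp p (fun z => 1 + ((k * Real.exp (-t) : ℝ) : ℂ) * z)
          * maxModulus (derivative (Pt t)) 1 := by
    have he := Real.exp_pos t
    have hlt : k * Real.exp (-t) < 1 := by
      have : Real.exp (-t) < 1 := by simpa using ht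
      nlinarith [Real.exp_pos (-t)]
    have hdegt : (Pt t).natDegree = n := by
      rw [natDegree_comp, natDegree_C_mul_X _ (by exact_mod_cast he.ne'), mul_one, hnat]
    have hmt : minModulus (Pt t) (k * Real.exp (-t)) = m := by
      rw [minModulus_comp_C_mul_X P he, mul_left_comm, ← Real.exp_add, add_neg_cancel,
        Real.exp_zero, mul_one]
    have h := natDegree_mul_circleLp_le (P := Pt t) (c := c t) (p := p) (by positivity) hlt ?_
      (by rwa [hdegt]) ?_ hp
    · rwa [hdegt] at h
    · intro z hz
      rw [hPt] at hz
      have := hzeros _ hz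
      rw [norm_mul, Complex.norm_real, Real.norm_of_nonneg he.le] at this
      rw [Real.exp_neg, ← div_eq_mul_inv, le_div_iff₀' he]
      exact this
    · rw [hmt, hdegt, Real.exp_neg]
      simp only [c, norm_mul, norm_div, norm_pow, Complex.norm_real, Real.norm_of_nonneg he.le,
        Real.norm_of_nonneg hm0, Real.norm_of_nonneg hk0.le]
      obtain ⟨j, rfl⟩ := Nat.exists_eq_succ_of_ne_zero hn
      calc m * ‖β‖ / k ^ (j.succ - 1) * Real.exp t ^ (j.succ - 1)
          ≤ m * 1 / k ^ (j.succ - 1) * Real.exp t ^ (j.succ - 1) := by gcongr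
        _ = _ := by
          rw [Nat.succ_sub_one, Nat.succ_eq_add_one, mul_pow, pow_succ, pow_succ, inv_pow]
          field_simp
  have hl : Continuous fun t => n * circleLp p (fun z => (Pt t).eval z + c t) := by
    refine continuous_const.mul (continuous_circleLp hp (F := fun t z => (Pt t).eval z + c t) ?_)
    simp only [hPt, c]
    exact (P.continuous.comp (hexp.mul continuous_snd)).add (continuous_const.mul (hexp.pow _))
  have hr : Continuous fun t => circleLp p (fun z => 1 + ((k * Real.exp (-t) : ℝ) : ℂ) * z)
          * maxModulus (derivative (Pt t)) 1 := by
    refine (continuous_circleLp hp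
      (F := fun t z => 1 + ((k * Real.exp (-t) : ℝ) : ℂ) * z) (by fun_prop)).mul
      (continuous_maxModulus (Q := fun t => derivative (Pt t)) ?_ 1)
    simp only [hPt']
    exact hexp.mul ((derivative P).continuous.comp (hexp.mul continuous_snd))
  -- Both sides are continuous in `t`, so letting `t` decrease to 0 gives the inequality for `P`,
  -- with `k = 1` included.
  have hlim := le_of_tendsto_of_tendsto (b := nhdsWithin 0 (Set.Ioi 0)) ((hl.tendsto 0).mono_left nhdsWithin_le_nhds)
    ((hr.tendsto 0).mono_left nhdsWithin_le_nhds)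
    (by filter_upwards [self_mem_nhdsWithin] with t ht using hineq t ht)
  simpa [Pt, c, hpow] using hlim
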